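/- Let $A$ be a finite alphabet. A sequence $x = x_1x_2x_3\cdots \in A^{\mathbb{N}}$ is normal if for every word $w \in A^*$ the number of occurrences of $w$ in $x_1\cdots x_n$, divided by $n$, tends to $(\#A)^{-|w|}$ as $n \to \infty$. A language $L \subseteq A^*$ is a regular group set if it is accepted by a deterministic finite automaton (with a single initial state) in which every symbol of $A$ induces a permutation of the set of states. Let $x \in A^{\mathbb{N}}$ be a normal sequence and let $L \subseteq A^*$ be a non-empty regular group set. Then there are infinitely many integers $i \ge 1$ such that the prefix $x_1x_2\cdots x_i$ (which includes $x_i$) belongs to $L$, and, if $i_1 < i_2 < i_3 < \cdots$ is their enumeration in increasing order, the sequence $x_{i_1}x_{i_2}x_{i_3}\cdots$ obtained by non-oblivious selection of $x$ by $L$ is normal. -/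

import Mathlib

namespace NormalSelection

universe u

/-- The prefix of length `n` of the sequence `x`. The first symbol of `x` is `x 0`. -/
def seqPrefix {A : Type u} (x : ℕ → A) (n : ℕ) : List A :=
  (List.range n).map x

/-- The number of occurrences of the word `w` in the word `v`: the number of positions of `v`
at which a copy of `w` starts. -/
noncomputable def occ {A : Type u} (v w : List A) : ℕ :=
  Set.ncard {i : ℕ | i < v.length ∧ w <+: v.drop i}

/-- A sequence is normal if every finite word `w` occurs in it with limiting frequency
`(#A) ^ (-|w|)`. -/
def IsNormal {A : Type u} [Fintype A] (x : ℕ → A) : Prop :=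
  ∀ w : List A,
    Filter.Tendsto (fun n : ℕ => (occ (seqPrefix x n) w : ℝ) / (n : ℝ)) Filter.atTop
      (nhds (((Fintype.card A : ℝ) ^ w.length)⁻¹))

/-- A group automaton: every symbol induces a permutation of the states. -/
def IsGroupAutomaton {A : Type u} {Q : Type} (M : DFA A Q) : Prop :=
  ∀ a : A, Function.Bijective (fun q : Q => M.step q a)

/-- A regular group set: a language accepted by a finite group automaton. -/
def IsGroupSet {A : Type u} (L : Language A) : Prop :=
  ∃ (Q : Type) (_ : Fintype Q) (M : DFA A Q), IsGroupAutomaton M ∧ M.accepts = L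

/-- The (0-based) position `i` is selected by `L` from `x` when the prefix of `x` that ends with
the symbol `x i`, this symbol included, belongs to `L`. -/
def Selected {A : Type u} (x : ℕ → A) (L : Language A) (i : ℕ) : Prop :=
  seqPrefix x (i + 1) ∈ L

/-- Non-oblivious selection: the symbols of `x` at the selected positions, in increasing order
of position. This is meaningful as a sequence when infinitely many positions are selected. -/
noncomputable def select {A : Type u} (x : ℕ → A) (L : Language A) : ℕ → A :=
  fun j => x (Nat.nth (Selected x L) j)

end NormalSelection

/-! Along an ultrafilter `U` finer than `atTop`, every bounded sequence has a limiting average, and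
this mean is linear and shift-invariant. Betting with finite memory gains nothing on a normal
sequence (`mean_centered_eq_zero`), so the next symbol is uniform given the automaton state and
boundedly many of the last selected symbols.

Let h_v(q) be the mean frequency of being in state q with v the most recent selected symbols, latest
first. Symbols act by permutations, so q has exactly one predecessor for each symbol. Entering q
outside F selects nothing, so h_v(q) is the average of h_v over the predecessors; entering q in F by
the symbol a selects a, so h_{av}(q) is h_v at the a-predecessor divided by #A. Induction on v with
a maximum principle (`eq_of_harmonic_off`) shows that h_v is constant on reachable states, with a
factor 1/#A for each letter (`mean_state_history_eq`).

Summing over F gives the frequency of v among selected symbols. The limit does not depend on `U`, so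
it is a genuine limit. -/

namespace NormalSelection

open Filter Topology

/-! ### Occurrences of a word, counted where they end -/

section Occurrences

variable {A : Type*}

/-- The real-valued indicator of a proposition. -/
noncomputable def ind (P : Prop) : ℝ := by
  classical exact if P then 1 else 0

theorem ind_true {P : Prop} (h : P) : ind P = 1 := by simp [ind, h]

theorem ind_false {P : Prop} (h : ¬P) : ind P = 0 := by simp [ind, h]

theorem ind_nonneg (P : Prop) : 0 ≤ ind P := by
  by_cases h : P <;> simp [ind, h]

theorem ind_le_one (P : Prop) : ind P ≤ 1 := by
  by_cases h : P <;> simp [ind, h]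

theorem abs_ind_le (P : Prop) : |ind P| ≤ 1 := by
  rw [abs_of_nonneg (ind_nonneg P)]
  exact ind_le_one P

theorem ind_congr {P Q : Prop} (h : P ↔ Q) : ind P = ind Q := by rw [propext h]

theorem ind_and (P Q : Prop) : ind (P ∧ Q) = ind P * ind Q := by
  by_cases hP : P <;> by_cases hQ : Q <;> simp [ind, hP, hQ]

theorem sum_ind_eq {B : Type*} [Fintype B] (b : B) (g : B → ℝ) :
    ∑ c, ind (b = c) * g c = g b := by
  classical
  rw [Finset.sum_eq_single b]
  · rw [ind_true rfl, one_mul]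
  · intro c _ hc
    rw [ind_false (Ne.symm hc), zero_mul]
  · simp

theorem seqPrefix_succ (x : ℕ → A) (n : ℕ) : seqPrefix x (n + 1) = seqPrefix x n ++ [x n] := by
  simp [seqPrefix, List.range_succ]

theorem seqPrefix_zero (x : ℕ → A) : seqPrefix x 0 = [] := rfl

theorem occ_nil (w : List A) : occ [] w = 0 := by simp [occ]

theorem occ_append_singleton (v : List A) (a : A) (w : List A) :
    (occ (v ++ [a]) w : ℝ) = occ v w + ind (w <:+ v ++ [a]) := by
  -- The `max 1` covers the empty word, whose new occurrence is at `v.length` because positions stay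
  -- below the length.
  have hset : {i : ℕ | i < (v ++ [a]).length ∧ w <+: (v ++ [a]).drop i} =
      {i : ℕ | i < v.length ∧ w <+: v.drop i} ∪
        {i : ℕ | w <:+ v ++ [a] ∧ i = v.length + 1 - max 1 w.length} := by
    ext i
    simp only [Set.mem_ofPred_eq, Set.mem_union, List.length_append, List.length_singleton]
    constructor
    · rintro ⟨hi, hp⟩
      rw [List.drop_append_of_le_length (by omega)] at hp
      by_cases h : w <+: v.drop i ∧ i < v.length
      · exact Or.inl ⟨h.2, h.1⟩
      · right
        rw [List.prefix_concat_iff] at hp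
        rcases hp with hp | hp
        · refine ⟨?_, ?_⟩
          · rw [hp]
            exact ⟨v.take i, by rw [← List.append_assoc, List.take_append_drop]⟩
          · rw [hp]
            simp only [List.length_append, List.length_drop, List.length_singleton]
            omega
        · have hiv : i = v.length := by
            by_contra hne
            exact h ⟨hp, by omega⟩
          subst hiv
          simp only [List.drop_length, List.prefix_nil] at hp
          subst hp
          exact ⟨List.nil_suffix, by simp⟩
    · rintro (⟨hi, hp⟩ | ⟨hs, hi⟩)
      · refine ⟨by omega, ?_⟩
        rw [List.drop_append_of_le_length (by omega)]
        exact hp.trans (List.prefix_append _ _)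
      · have hl := hs.length_le
        simp only [List.length_append, List.length_singleton] at hl
        refine ⟨by omega, ?_⟩
        by_cases hw : w = []
        · simp [hw]
        · have hpos : 0 < w.length := List.length_pos_iff.mpr hw
          have hi' : i = (v ++ [a]).length - w.length := by
            simp only [List.length_append, List.length_singleton]
            omega
          rw [hi', ← List.suffix_iff_eq_drop.mp hs]
  have hfin : {i : ℕ | i < v.length ∧ w <+: v.drop i}.Finite :=
    (Set.finite_lt_nat v.length).subset fun i hi => hi.1
  have hfin' : {i : ℕ | w <:+ v ++ [a] ∧ i = v.length + 1 - max 1 w.length}.Finite :=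
    (Set.finite_singleton _).subset fun i hi => hi.2
  have hdisj : Disjoint {i : ℕ | i < v.length ∧ w <+: v.drop i}
      {i : ℕ | w <:+ v ++ [a] ∧ i = v.length + 1 - max 1 w.length} := by
    rw [Set.disjoint_left]
    rintro i ⟨hi, hp⟩ ⟨hs, hi'⟩
    have h1 := hp.length_le
    have h2 := hs.length_le
    simp only [List.length_drop, List.length_append, List.length_singleton] at h1 h2
    omega
  unfold occ
  rw [hset, Set.ncard_union_eq hdisj hfin hfin']
  by_cases hs : w <:+ v ++ [a]
  · rw [ind_true hs]
    simp [hs]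
  · rw [ind_false hs]
    simp [hs]

theorem occ_seqPrefix (x : ℕ → A) (w : List A) (n : ℕ) :
    (occ (seqPrefix x n) w : ℝ) = ∑ i ∈ Finset.range n, ind (w <:+ seqPrefix x (i + 1)) := by
  induction n with
  | zero => simp [seqPrefix_zero, occ_nil]
  | succ n ih =>
    rw [Finset.sum_range_succ, seqPrefix_succ, occ_append_singleton, ih]

end Occurrences

/-! ### Cesàro means along an ultrafilter -/

section Mean

/-- The average of the first `n` values of `f`. -/
noncomputable def cesaro (f : ℕ → ℝ) (n : ℕ) : ℝ := (∑ i ∈ Finset.range n, f i) / n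

/-- A real sequence is bounded. -/
def Bdd (f : ℕ → ℝ) : Prop := ∃ C, ∀ i, |f i| ≤ C

theorem Bdd.const (c : ℝ) : Bdd fun _ => c := ⟨|c|, fun _ => le_rfl⟩

theorem Bdd.ind (P : ℕ → Prop) : Bdd fun i => ind (P i) := ⟨1, fun i => abs_ind_le (P i)⟩

theorem Bdd.add {f g : ℕ → ℝ} (hf : Bdd f) (hg : Bdd g) : Bdd fun i => f i + g i := by
  obtain ⟨C, hC⟩ := hf
  obtain ⟨D, hD⟩ := hg
  exact ⟨C + D, fun i => (abs_add_le _ _).trans (add_le_add (hC i) (hD i))⟩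

theorem Bdd.mul {f g : ℕ → ℝ} (hf : Bdd f) (hg : Bdd g) : Bdd fun i => f i * g i := by
  obtain ⟨C, hC⟩ := hf
  obtain ⟨D, hD⟩ := hg
  refine ⟨C * D, fun i => ?_⟩
  rw [abs_mul]
  exact mul_le_mul (hC i) (hD i) (abs_nonneg _) ((abs_nonneg _).trans (hC i))

theorem Bdd.sum {ι : Type*} {s : Finset ι} {f : ι → ℕ → ℝ} (hf : ∀ j ∈ s, Bdd (f j)) :
    Bdd fun i => ∑ j ∈ s, f j i := by
  classical
  induction s using Finset.induction_on with
  | empty => simpa using Bdd.const 0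
  | insert a s ha ih =>
    simp only [Finset.sum_insert ha]
    exact (hf a (Finset.mem_insert_self a s)).add
      (ih fun j hj => hf j (Finset.mem_insert_of_mem hj))

theorem Bdd.shift {f : ℕ → ℝ} (hf : Bdd f) (k : ℕ) : Bdd fun i => f (i + k) := by
  obtain ⟨C, hC⟩ := hf
  exact ⟨C, fun i => hC _⟩

/-- The limit of the averages of `f` along the ultrafilter `U`. -/
noncomputable def mean (U : Ultrafilter ℕ) (f : ℕ → ℝ) : ℝ := limUnder (U : Filter ℕ) (cesaro f)

variable {U : Ultrafilter ℕ}

/-- The averages stay in a compact interval, where every ultrafilter converges. -/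
theorem tendsto_mean (U : Ultrafilter ℕ) {f : ℕ → ℝ} (hf : Bdd f) :
    Tendsto (cesaro f) U (𝓝 (mean U f)) := by
  obtain ⟨C, hC⟩ := hf
  have hC0 : 0 ≤ C := (abs_nonneg _).trans (hC 0)
  have hb : ∀ n, cesaro f n ∈ Set.Icc (-C) C := by
    intro n
    rw [Set.mem_Icc, ← abs_le, cesaro, abs_div, Nat.abs_cast]
    refine div_le_of_le_mul₀ (Nat.cast_nonneg n) hC0 ?_
    refine (Finset.abs_sum_le_sum_abs _ _).trans ?_
    refine (Finset.sum_le_sum fun i _ => hC i).trans ?_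
    simp [mul_comm]
  obtain ⟨a, -, ha⟩ := (isCompact_Icc (a := -C) (b := C)).ultrafilter_le_nhds
    (U.map (cesaro f)) (tendsto_principal.mpr (Eventually.of_forall hb))
  exact tendsto_nhds_limUnder ⟨a, ha⟩

theorem mean_eq_of_tendsto {f : ℕ → ℝ} {c : ℝ} (h : Tendsto (cesaro f) U (𝓝 c)) :
    mean U f = c := h.limUnder_eq

theorem mean_add {f g : ℕ → ℝ} (hf : Bdd f) (hg : Bdd g) :
    mean U (fun i => f i + g i) = mean U f + mean U g := by
  refine mean_eq_of_tendsto (((tendsto_mean U hf).add (tendsto_mean U hg)).congr fun n => ?_)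
  simp only [cesaro, Finset.sum_add_distrib, add_div]

theorem mean_const_mul {f : ℕ → ℝ} (hf : Bdd f) (c : ℝ) :
    mean U (fun i => c * f i) = c * mean U f := by
  refine mean_eq_of_tendsto (((tendsto_mean U hf).const_mul c).congr fun n => ?_)
  simp only [cesaro, ← Finset.mul_sum, mul_div_assoc]

theorem mean_zero : mean U (fun _ => 0) = 0 :=
  mean_eq_of_tendsto (tendsto_const_nhds.congr fun n => by simp [cesaro])

theorem mean_sum {ι : Type*} {s : Finset ι} {f : ι → ℕ → ℝ} (hf : ∀ j ∈ s, Bdd (f j)) :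
    mean U (fun i => ∑ j ∈ s, f j i) = ∑ j ∈ s, mean U (f j) := by
  classical
  induction s using Finset.induction_on with
  | empty => simp [mean_zero]
  | insert a s ha ih =>
    have hs : ∀ j ∈ s, Bdd (f j) := fun j hj => hf j (Finset.mem_insert_of_mem hj)
    simp only [Finset.sum_insert ha]
    rw [mean_add (hf a (Finset.mem_insert_self a s)) (Bdd.sum hs), ih hs]

theorem mean_mono {f g : ℕ → ℝ} (hf : Bdd f) (hg : Bdd g) (h : ∀ i, f i ≤ g i) :
    mean U f ≤ mean U g := by
  refine le_of_tendsto_of_tendsto' (tendsto_mean U hf) (tendsto_mean U hg) fun n => ?_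
  exact div_le_div_of_nonneg_right (Finset.sum_le_sum fun i _ => h i) (Nat.cast_nonneg n)

theorem mean_one (hU : (U : Filter ℕ) ≤ atTop) : mean U (fun _ => 1) = 1 := by
  refine mean_eq_of_tendsto (Tendsto.congr' ?_ tendsto_const_nhds)
  filter_upwards [hU (eventually_gt_atTop 0)] with n hn
  have : (n : ℝ) ≠ 0 := by exact_mod_cast hn.ne'
  simp [cesaro, this]

theorem mean_succ (hU : (U : Filter ℕ) ≤ atTop) {f : ℕ → ℝ} (hf : Bdd f) :
    mean U (fun i => f (i + 1)) = mean U f := by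
  obtain ⟨C, hC⟩ := hf
  have h0 : Tendsto (fun n : ℕ => (f n - f 0) / n) atTop (𝓝 0) := by
    refine squeeze_zero_norm (a := fun n : ℕ => (2 * C) / n) (fun n => ?_)
      (tendsto_const_div_atTop_nhds_zero_nat _)
    rw [Real.norm_eq_abs, abs_div, Nat.abs_cast]
    refine div_le_div_of_nonneg_right ?_ (Nat.cast_nonneg n)
    refine (abs_sub _ _).trans ?_
    linarith [hC n, hC 0]
  have h1 := (tendsto_mean U ⟨C, hC⟩).add (h0.mono_left hU)
  rw [add_zero] at h1
  refine mean_eq_of_tendsto (h1.congr fun n => ?_)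
  have h2 := Finset.sum_range_succ f n
  rw [Finset.sum_range_succ'] at h2
  simp only [cesaro]
  rw [← add_div]
  congr 1
  linarith

theorem mean_shift (hU : (U : Filter ℕ) ≤ atTop) {f : ℕ → ℝ} (hf : Bdd f) (k : ℕ) :
    mean U (fun i => f (i + k)) = mean U f := by
  induction k with
  | zero => rfl
  | succ k ih =>
    rw [← ih, ← mean_succ hU (hf.shift k)]
    congr 1
    ext i
    congr 1
    omega

/-- The mean of `(f i - t) ^ 2` is nonnegative. -/
theorem sq_mean_le (hU : (U : Filter ℕ) ≤ atTop) {f : ℕ → ℝ} (hf : Bdd f) :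
    mean U f ^ 2 ≤ mean U (fun i => f i ^ 2) := by
  set t := mean U f with ht
  have hsq : Bdd fun i => f i ^ 2 := by simpa only [sq] using hf.mul hf
  have hm : Bdd fun i => (-2 * t) * f i := (Bdd.const _).mul hf
  have hc : Bdd fun _ => t ^ 2 * 1 := Bdd.const _
  have h : mean U (fun _ => 0) ≤ mean U (fun i => f i ^ 2 + (-2 * t) * f i + t ^ 2 * 1) :=
    mean_mono (Bdd.const 0) ((hsq.add hm).add hc) fun i => by nlinarith [sq_nonneg (f i - t)]
  rw [mean_zero, mean_add (hsq.add hm) hc, mean_add hsq hm, mean_const_mul hf,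
    mean_const_mul (Bdd.const 1), mean_one hU, ← ht] at h
  nlinarith

end Mean

/-! ### Windows of a normal sequence behave like independent uniform words -/

section Windows

variable {A : Type*}

/-- The word of length `n` of `x` that starts at position `i`. -/
def window (x : ℕ → A) : ℕ → ℕ → List A
  | _, 0 => []
  | i, n + 1 => x i :: window x (i + 1) n

theorem window_succ' (x : ℕ → A) (i n : ℕ) :
    window x i (n + 1) = window x i n ++ [x (i + n)] := by
  induction n generalizing i with
  | zero => simp [window]
  | succ n ih =>
    rw [window, ih, window, List.cons_append]
    congr 4
    omega

theorem length_window (x : ℕ → A) (i n : ℕ) : (window x i n).length = n := by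
  induction n generalizing i with
  | zero => rfl
  | succ n ih => simp [window, ih]

theorem seqPrefix_add (x : ℕ → A) (i n : ℕ) :
    seqPrefix x (i + n) = seqPrefix x i ++ window x i n := by
  induction n with
  | zero => simp [window]
  | succ n ih => rw [← add_assoc, seqPrefix_succ, ih, window_succ', List.append_assoc]

theorem window_eq_iff (x : ℕ → A) (i : ℕ) (w : List A) :
    window x i w.length = w ↔ w <:+ seqPrefix x (i + w.length) := by
  rw [seqPrefix_add]
  constructor
  · intro h
    rw [h]
    exact List.suffix_append _ _
  · intro h
    have h' := List.suffix_of_suffix_length_le h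
      (List.suffix_append (seqPrefix x i) (window x i w.length)) (by rw [length_window])
    exact (h'.eq_of_length (length_window x i _).symm).symm

variable [Fintype A]

/-- The expectation of `f` over the words of length `n`, with independent uniform symbols. -/
noncomputable def expect : ℕ → (List A → ℝ) → ℝ
  | 0, f => f []
  | n + 1, f => (Fintype.card A : ℝ)⁻¹ * ∑ a, expect n fun u => f (a :: u)

theorem expect_add (n : ℕ) (f g : List A → ℝ) :
    expect n (fun u => f u + g u) = expect n f + expect n g := by
  induction n generalizing f g with
  | zero => rfl
  | succ n ih => simp only [expect, ih, Finset.sum_add_distrib, mul_add]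

theorem expect_const_mul (n : ℕ) (c : ℝ) (f : List A → ℝ) :
    expect n (fun u => c * f u) = c * expect n f := by
  induction n generalizing f with
  | zero => rfl
  | succ n ih =>
    simp only [expect, ih, ← Finset.mul_sum]
    ring

theorem expect_const [Nonempty A] (n : ℕ) (c : ℝ) : expect n (fun _ : List A => c) = c := by
  induction n with
  | zero => rfl
  | succ n ih =>
    simp only [expect, ih, Finset.sum_const, Finset.card_univ, nsmul_eq_mul]
    field_simp

theorem bdd_window (x : ℕ → A) (f : List A → ℝ) (k n : ℕ) :
    Bdd fun i => f (window x (i + k) n) := by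
  have hfin : {l : List A | l.length ≤ n}.Finite := List.finite_length_le A n
  obtain ⟨C, hC⟩ := (hfin.image fun l => |f l|).bddAbove
  exact ⟨C, fun i => hC ⟨_, by simp [length_window], rfl⟩⟩

variable {U : Ultrafilter ℕ} {x : ℕ → A}

/-- The one place where the definition of normality is used; shift-invariance passes from end
positions to start positions. -/
theorem mean_ind_window_eq (hU : (U : Filter ℕ) ≤ atTop) (hx : IsNormal x) (w : List A) :
    mean U (fun i => ind (window x i w.length = w)) = ((Fintype.card A : ℝ) ^ w.length)⁻¹ := by
  have h1 : mean U (fun i => ind (w <:+ seqPrefix x (i + 1))) =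
      ((Fintype.card A : ℝ) ^ w.length)⁻¹ := by
    refine mean_eq_of_tendsto (((hx w).mono_left hU).congr fun n => ?_)
    rw [occ_seqPrefix, cesaro]
  have hb : Bdd fun i => ind (w <:+ seqPrefix x i) := Bdd.ind _
  simp only [window_eq_iff]
  rw [mean_shift hU hb, ← mean_shift hU hb 1, h1]

/-- The word `w` is there for the induction: each step moves the first symbol of the window from the
argument of `f` to the end of `w`. -/
theorem mean_ind_mul_window (hU : (U : Filter ℕ) ≤ atTop) (hx : IsNormal x) (n : ℕ)
    (f : List A → ℝ) (w : List A) :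
    mean U (fun i => ind (window x i w.length = w) * f (window x (i + w.length) n)) =
      ((Fintype.card A : ℝ) ^ w.length)⁻¹ * expect n f := by
  induction n generalizing f w with
  | zero =>
    simp only [window, expect, mul_comm _ (f [])]
    rw [mean_const_mul (Bdd.ind _), mean_ind_window_eq hU hx]
  | succ n ih =>
    have key : ∀ i, ind (window x i w.length = w) * f (window x (i + w.length) (n + 1)) =
        ∑ a, ind (window x i (w ++ [a]).length = w ++ [a]) *
          f (a :: window x (i + (w ++ [a]).length) n) := by
      intro i
      have h : ∀ a, ind (window x i (w ++ [a]).length = w ++ [a]) =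
          ind (x (i + w.length) = a) * ind (window x i w.length = w) := by
        intro a
        rw [← ind_and]
        refine ind_congr ?_
        rw [List.length_append, List.length_singleton, window_succ',
          List.append_singleton_inj, and_comm]
      simp only [h, mul_assoc]
      rw [sum_ind_eq (x (i + w.length)) fun a =>
        ind (window x i w.length = w) * f (a :: window x (i + (w ++ [a]).length) n)]
      simp [window, add_assoc]
    simp only [key]
    rw [mean_sum fun a _ => (Bdd.ind _).mul (bdd_window x (fun u => f (a :: u)) _ n)]
    have ih' : ∀ a, mean U (fun i => ind (window x i (w ++ [a]).length = w ++ [a]) *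
        f (a :: window x (i + (w ++ [a]).length) n)) =
        ((Fintype.card A : ℝ) ^ w.length)⁻¹ * ((Fintype.card A : ℝ)⁻¹ *
          expect n fun u => f (a :: u)) := by
      intro a
      rw [ih (fun u => f (a :: u)) (w ++ [a]), List.length_append, List.length_singleton,
        pow_succ, mul_inv, mul_assoc]
    simp only [ih', expect, ← Finset.mul_sum]

theorem mean_window (hU : (U : Filter ℕ) ≤ atTop) (hx : IsNormal x) (n : ℕ) (f : List A → ℝ) :
    mean U (fun i => f (window x i n)) = expect n f := by
  have h := mean_ind_mul_window hU hx n f []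
  simpa [window, ind] using h

end Windows

/-! ### No gain from finite-memory betting -/

section Machines

variable {A : Type*} {S : Type*}

/-- The total reward of the run from `s` on a word. -/
def reward (step : S → A → S) (d : S → A → ℝ) : S → List A → ℝ
  | _, [] => 0
  | s, a :: u => d s a + reward step d (step s a) u

variable {step : S → A → S} {d : S → A → ℝ}

variable {x : ℕ → A} {s : ℕ → S}

theorem reward_window (hs : ∀ i, s (i + 1) = step (s i) (x i)) (i n : ℕ) :
    reward step d (s i) (window x i n) = ∑ j ∈ Finset.range n, d (s (i + j)) (x (i + j)) := by
  induction n generalizing i with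
  | zero => rfl
  | succ n ih =>
    rw [window, reward, ← hs, ih, Finset.sum_range_succ', add_comm]
    simp only [add_zero, add_assoc, add_comm 1]

variable [Fintype A]

theorem expect_reward (hd : ∀ s, ∑ a, d s a = 0) [Nonempty A] (n : ℕ) (s : S) :
    expect n (reward step d s) = 0 := by
  induction n generalizing s with
  | zero => rfl
  | succ n ih =>
    simp only [expect, reward, expect_add, expect_const]
    simp only [show ∀ s, expect n (fun u => reward step d s u) = 0 from ih, add_zero, hd, mul_zero]

/-- Rewards at different times are orthogonal: the cross term vanishes by `expect_reward`. -/
theorem expect_reward_sq_le (hd : ∀ s, ∑ a, d s a = 0) (hd1 : ∀ s a, |d s a| ≤ 1) [Nonempty A]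
    (n : ℕ) (s : S) : expect n (fun u => reward step d s u ^ 2) ≤ n := by
  induction n generalizing s with
  | zero => simp [expect, reward]
  | succ n ih =>
    have h : ∀ a, expect n (fun u => reward step d s (a :: u) ^ 2) ≤ 1 + n := by
      intro a
      have h1 : ∀ u, reward step d s (a :: u) ^ 2 =
          d s a ^ 2 + (2 * d s a) * reward step d (step s a) u +
            reward step d (step s a) u ^ 2 := by
        intro u
        rw [reward]
        ring
      simp only [h1, expect_add, expect_const, expect_const_mul]
      rw [show expect n (fun u => reward step d (step s a) u) = 0 from expect_reward hd n _,
        mul_zero, add_zero]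
      exact add_le_add ((sq_le_one_iff_abs_le_one _).mpr (hd1 s a)) (ih _)
    have hc : (0 : ℝ) < Fintype.card A := by exact_mod_cast Fintype.card_pos
    rw [expect, inv_mul_le_iff₀ hc]
    refine (Finset.sum_le_sum fun a _ => h a).trans ?_
    simp [add_comm, mul_add]

variable {U : Ultrafilter ℕ}

/-- A second-moment argument: the reward over `n` steps has mean `n * t`, while its mean square
grows only linearly in `n`. -/
theorem mean_centered_eq_zero (hU : (U : Filter ℕ) ≤ atTop) (hx : IsNormal x)
    (hs : ∀ i, s (i + 1) = step (s i) (x i)) (hfin : (Set.range s).Finite)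
    (hd : ∀ s, ∑ a, d s a = 0) (hd1 : ∀ s a, |d s a| ≤ 1) :
    mean U (fun i => d (s i) (x i)) = 0 := by
  have : Nonempty A := ⟨x 0⟩
  have hb : Bdd fun i => d (s i) (x i) := ⟨1, fun i => hd1 _ _⟩
  have hbj : ∀ j, Bdd fun i => d (s (i + j)) (x (i + j)) := fun j => hb.shift j
  set t := mean U (fun i => d (s i) (x i)) with ht
  set T := hfin.toFinset with hT
  have key : ∀ n : ℕ, (n * t) ^ 2 ≤ T.card * n := by
    intro n
    have hbs : Bdd fun i => ∑ j ∈ Finset.range n, d (s (i + j)) (x (i + j)) :=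
      Bdd.sum fun j _ => hbj j
    have h1 : mean U (fun i => ∑ j ∈ Finset.range n, d (s (i + j)) (x (i + j))) = n * t := by
      rw [mean_sum fun j _ => hbj j]
      simp only [fun j => mean_shift hU hb j, ← ht, Finset.sum_const, Finset.card_range,
        nsmul_eq_mul]
    have hbw : ∀ p, Bdd fun i => reward step d p (window x i n) ^ 2 :=
      fun p => bdd_window x (fun u => reward step d p u ^ 2) 0 n
    rw [← h1]
    refine (sq_mean_le hU hbs).trans ?_
    -- The starting state depends on the past, so its squared reward is bounded by the sum over all
    -- possible starting states.
    have h2 : mean U (fun i => (∑ j ∈ Finset.range n, d (s (i + j)) (x (i + j))) ^ 2) ≤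
        mean U (fun i => ∑ p ∈ T, reward step d p (window x i n) ^ 2) := by
      refine mean_mono (by simpa only [sq] using hbs.mul hbs) (Bdd.sum fun p _ => hbw p) ?_
      intro i
      rw [← reward_window hs]
      exact Finset.single_le_sum (f := fun p => reward step d p (window x i n) ^ 2)
        (fun p _ => sq_nonneg _) (hfin.mem_toFinset.mpr ⟨i, rfl⟩)
    refine h2.trans ?_
    rw [mean_sum fun p _ => hbw p]
    refine (Finset.sum_le_sum (g := fun _ => (n : ℝ)) fun p _ => ?_).trans (by simp)
    rw [mean_window hU hx n fun u => reward step d p u ^ 2]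
    exact expect_reward_sq_le hd hd1 n p
  by_contra hne
  have ht0 : 0 < t ^ 2 := by positivity
  obtain ⟨n, hn⟩ := exists_nat_gt ((T.card : ℝ) / t ^ 2)
  have hn0 : (0 : ℝ) < n := lt_of_le_of_lt (by positivity) hn
  rw [div_lt_iff₀ ht0] at hn
  nlinarith [key n]

theorem mean_state_symbol (hU : (U : Filter ℕ) ≤ atTop) (hx : IsNormal x)
    (hs : ∀ i, s (i + 1) = step (s i) (x i)) (hfin : (Set.range s).Finite) (P : S → Prop)
    (a : A) :
    mean U (fun i => ind (P (s i) ∧ x i = a)) =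
      (Fintype.card A : ℝ)⁻¹ * mean U (fun i => ind (P (s i))) := by
  have : Nonempty A := ⟨x 0⟩
  have hc : (1 : ℝ) ≤ Fintype.card A := by exact_mod_cast Fintype.card_pos
  have hc0 : 0 ≤ (Fintype.card A : ℝ)⁻¹ := by positivity
  have hc1 : (Fintype.card A : ℝ)⁻¹ ≤ 1 := inv_le_one_of_one_le₀ hc
  have h := mean_centered_eq_zero (d := fun p b => ind (P p) * (ind (a = b) -
    (Fintype.card A : ℝ)⁻¹)) hU hx hs hfin ?_ ?_
  · have h1 : ∀ i, ind (P (s i)) * (ind (a = x i) - (Fintype.card A : ℝ)⁻¹) =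
        ind (P (s i) ∧ x i = a) + (-(Fintype.card A : ℝ)⁻¹) * ind (P (s i)) := by
      intro i
      rw [ind_and, ind_congr (eq_comm (a := a))]
      ring
    simp only [h1] at h
    rw [mean_add (Bdd.ind _) ((Bdd.const _).mul (Bdd.ind _)), mean_const_mul (Bdd.ind _)] at h
    linarith
  · intro p
    have h2 := sum_ind_eq a fun _ => (1 : ℝ)
    simp only [mul_one] at h2
    rw [← Finset.mul_sum, Finset.sum_sub_distrib, h2]
    simp
  · intro p b
    rw [abs_mul]
    refine mul_le_one₀ (abs_ind_le _) (abs_nonneg _) ?_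
    rw [abs_le]
    constructor <;> linarith [ind_nonneg (a = b), ind_le_one (a = b)]

end Machines

/-! ### A maximum principle for permutation walks -/

section MaximumPrinciple

variable {A : Type*} {Q : Type*}

/-- The states that a family of permutations reaches from `q₀`. -/
def reach (e : A → Equiv.Perm Q) (q₀ : Q) : Set Q :=
  {q | ∃ u : List A, u.foldl (fun p a => e a p) q₀ = q}

variable {e : A → Equiv.Perm Q} {q₀ : Q}

theorem self_mem_reach : q₀ ∈ reach e q₀ := ⟨[], rfl⟩

theorem apply_mem_reach {q : Q} (hq : q ∈ reach e q₀) (a : A) : e a q ∈ reach e q₀ := by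
  obtain ⟨u, rfl⟩ := hq
  exact ⟨u ++ [a], by simp⟩

theorem foldl_mem {Z : Set Q} (h : ∀ q ∈ Z, ∀ a, e a q ∈ Z) (u : List A) {q : Q} (hq : q ∈ Z) :
    u.foldl (fun p a => e a p) q ∈ Z := by
  induction u generalizing q with
  | nil => exact hq
  | cons a u ih => exact ih (h q hq a)

theorem mem_of_foldl_mem {Z : Set Q} (h : ∀ q ∈ Z, ∀ a, (e a).symm q ∈ Z) (u : List A) {q : Q}
    (hq : u.foldl (fun p a => e a p) q ∈ Z) : q ∈ Z := by
  induction u generalizing q with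
  | nil => exact hq
  | cons a u ih => simpa using h _ (ih hq) a

variable [Finite Q]

theorem symm_mem_of_forall_apply_mem (g : Equiv.Perm Q) {Z : Set Q} (h : ∀ q ∈ Z, g q ∈ Z) {q : Q}
    (hq : q ∈ Z) : g.symm q ∈ Z := by
  obtain ⟨p, hp⟩ := Finite.surjective_of_injective (f := fun p : Z => (⟨g p, h p p.2⟩ : Z))
    (fun p p' hpp => Subtype.ext (g.injective (congrArg Subtype.val hpp))) ⟨q, hq⟩
  rw [← show g p = q from congrArg Subtype.val hp, Equiv.symm_apply_apply]
  exact p.2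

variable [Fintype A]

/-- If no maximizer lay in `F`, all predecessors of a maximizer would be maximizers. By finiteness
this set is then closed under the permutations too, so it contains `q₀` and hence `f`, a
contradiction. -/
theorem le_of_harmonic_off [Nonempty A] {F : Set Q} {f : Q} (hfF : f ∈ F) (hf : f ∈ reach e q₀)
    {h : Q → ℝ} {c : ℝ} (hF : ∀ q ∈ reach e q₀, q ∈ F → h q = c)
    (hh : ∀ q ∈ reach e q₀, q ∉ F →
      h q = (Fintype.card A : ℝ)⁻¹ * ∑ a, h ((e a).symm q)) :
    ∀ q ∈ reach e q₀, h q ≤ c := by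
  have hc : (0 : ℝ) < Fintype.card A := by exact_mod_cast Fintype.card_pos
  obtain ⟨m, hmR, hm⟩ := Set.exists_max_image (reach e q₀) h (Set.toFinite _) ⟨q₀, self_mem_reach⟩
  suffices hs : ∃ z ∈ reach e q₀, h z = h m ∧ z ∈ F by
    obtain ⟨z, hzR, hz, hzF⟩ := hs
    intro q hq
    rw [← hF z hzR hzF, hz]
    exact hm q hq
  by_contra! hno
  have hback : ∀ q ∈ {z | z ∈ reach e q₀ ∧ h z = h m}, ∀ a,
      (e a).symm q ∈ {z | z ∈ reach e q₀ ∧ h z = h m} := by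
    rintro q ⟨hqR, hq⟩
    have hmem : ∀ a, (e a).symm q ∈ reach e q₀ := fun a =>
      symm_mem_of_forall_apply_mem (e a) (fun p hp => apply_mem_reach hp a) hqR
    have hsum := hh q hqR (hno q hqR hq)
    rw [hq, eq_inv_mul_iff_mul_eq₀ hc.ne'] at hsum
    have hall := (Finset.sum_eq_sum_iff_of_le (s := Finset.univ)
      (f := fun a => h ((e a).symm q)) (g := fun _ => h m) fun a _ => hm _ (hmem a)).mp
      (by simp [← hsum])
    exact fun a => ⟨hmem a, hall a (Finset.mem_univ a)⟩
  have hforw : ∀ q ∈ {z | z ∈ reach e q₀ ∧ h z = h m}, ∀ a,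
      e a q ∈ {z | z ∈ reach e q₀ ∧ h z = h m} := fun q hq a =>
    symm_mem_of_forall_apply_mem (e a).symm (fun p hp => hback p hp a) hq
  obtain ⟨v, hv⟩ := hmR
  have h0 : q₀ ∈ {z | z ∈ reach e q₀ ∧ h z = h m} :=
    mem_of_foldl_mem hback v (by rw [hv]; exact ⟨⟨v, hv⟩, rfl⟩)
  obtain ⟨u, hu⟩ := hf
  have hfZ := foldl_mem hforw u h0
  rw [hu] at hfZ
  exact hno f hfZ.1 hfZ.2 hfF

/-- A function that is harmonic for the reversed walk off `F` and constant on `F` is constant. -/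
theorem eq_of_harmonic_off [Nonempty A] {F : Set Q} {f : Q} (hfF : f ∈ F) (hf : f ∈ reach e q₀)
    {h : Q → ℝ} {c : ℝ} (hF : ∀ q ∈ reach e q₀, q ∈ F → h q = c)
    (hh : ∀ q ∈ reach e q₀, q ∉ F →
      h q = (Fintype.card A : ℝ)⁻¹ * ∑ a, h ((e a).symm q)) :
    ∀ q ∈ reach e q₀, h q = c := by
  intro q hq
  refine le_antisymm (le_of_harmonic_off hfF hf hF hh q hq) ?_
  have := le_of_harmonic_off (h := fun q => -h q) (c := -c) hfF hf
    (fun q hq hqF => by rw [hF q hq hqF])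
    (fun q hq hqF => by rw [hh q hq hqF, Finset.sum_neg_distrib, mul_neg]) q hq
  linarith

end MaximumPrinciple

/-! ### Joint frequencies of states and recently selected symbols -/

section Selection

variable {A : Type*} {Q : Type*}

/-- The state before the symbol at position `i` is read. -/
def state (e : A → Equiv.Perm Q) (q₀ : Q) (x : ℕ → A) : ℕ → Q
  | 0 => q₀
  | i + 1 => e (x i) (state e q₀ x i)

open Classical in
/-- The symbols selected before position `i`, the latest first: a symbol is selected when the
state after reading it is in `F`. -/
noncomputable def history (e : A → Equiv.Perm Q) (q₀ : Q) (F : Set Q) (x : ℕ → A) : ℕ → List A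
  | 0 => []
  | i + 1 => if state e q₀ x (i + 1) ∈ F then x i :: history e q₀ F x i else history e q₀ F x i

variable {e : A → Equiv.Perm Q} {q₀ : Q} {F : Set Q} {x : ℕ → A}

theorem state_mem_reach (i : ℕ) : state e q₀ x i ∈ reach e q₀ := by
  induction i with
  | zero => exact self_mem_reach
  | succ i ih => exact apply_mem_reach ih _

theorem state_succ_eq_iff (i : ℕ) (q : Q) :
    state e q₀ x (i + 1) = q ↔ state e q₀ x i = (e (x i)).symm q := by
  rw [state, Equiv.eq_symm_apply]

variable [Fintype A] [Fintype Q] {U : Ultrafilter ℕ}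

/-- Only the latest `v.length` selected symbols matter, so state and truncated history form a
finite-memory machine. -/
theorem mean_state_history_symbol (hU : (U : Filter ℕ) ≤ atTop) (hx : IsNormal x) (q : Q)
    (v : List A) (a : A) :
    mean U (fun i => ind ((state e q₀ x i = q ∧ v <+: history e q₀ F x i) ∧ x i = a)) =
      (Fintype.card A : ℝ)⁻¹ *
        mean U (fun i => ind (state e q₀ x i = q ∧ v <+: history e q₀ F x i)) := by
  classical
  have hP : ∀ i, (state e q₀ x i = q ∧ v <+: history e q₀ F x i) ↔
      (state e q₀ x i = q ∧ v <+: (history e q₀ F x i).take v.length) := by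
    intro i
    rw [List.prefix_take_iff]
    simp
  have h := mean_state_symbol (x := x) (U := U)
    (s := fun i => (state e q₀ x i, (history e q₀ F x i).take v.length))
    (step := fun s a => (e a s.1, if e a s.1 ∈ F then (a :: s.2).take v.length else s.2))
    hU hx ?_ ?_ (fun s => s.1 = q ∧ v <+: s.2) a
  · simpa only [hP] using h
  · intro i
    by_cases h : e (x i) (state e q₀ x i) ∈ F
    · cases v <;> simp [history, state, h, List.take_take]
    · simp [history, state, h]
  · refine ((Set.toFinite (Set.univ : Set Q)).prod (List.finite_length_le A v.length)).subset ?_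
    rintro _ ⟨i, rfl⟩
    exact ⟨trivial, by simp⟩

theorem mean_state_history_of_not_mem (hU : (U : Filter ℕ) ≤ atTop) (hx : IsNormal x) {q : Q}
    {v : List A} (hq : v = [] ∨ q ∉ F) :
    mean U (fun i => ind (state e q₀ x i = q ∧ v <+: history e q₀ F x i)) =
      (Fintype.card A : ℝ)⁻¹ * ∑ a,
        mean U (fun i => ind (state e q₀ x i = (e a).symm q ∧ v <+: history e q₀ F x i)) := by
  rw [← mean_succ hU (Bdd.ind _), Finset.mul_sum]
  rw [Finset.sum_congr rfl fun a _ => (mean_state_history_symbol hU hx ((e a).symm q) v a).symm]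
  rw [← mean_sum fun a _ => Bdd.ind _]
  congr 1
  ext i
  have h : ∀ a, ind ((state e q₀ x i = (e a).symm q ∧ v <+: history e q₀ F x i) ∧ x i = a) =
      ind (x i = a) * ind (state e q₀ x i = (e a).symm q ∧ v <+: history e q₀ F x i) := by
    intro a
    rw [← ind_and, and_comm]
  simp only [h]
  rw [sum_ind_eq (x i) fun a =>
    ind (state e q₀ x i = (e a).symm q ∧ v <+: history e q₀ F x i), ← state_succ_eq_iff]
  refine ind_congr (and_congr_right fun hqi => ?_)
  rcases hq with rfl | hq
  · simp
  · rw [history, if_neg (by rwa [hqi])]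

theorem mean_state_history_cons (hU : (U : Filter ℕ) ≤ atTop) (hx : IsNormal x) {q : Q}
    (hq : q ∈ F) (a : A) (v : List A) :
    mean U (fun i => ind (state e q₀ x i = q ∧ a :: v <+: history e q₀ F x i)) =
      (Fintype.card A : ℝ)⁻¹ *
        mean U (fun i => ind (state e q₀ x i = (e a).symm q ∧ v <+: history e q₀ F x i)) := by
  rw [← mean_state_history_symbol hU hx _ _ a,
    ← mean_succ hU (Bdd.ind fun i => state e q₀ x i = q ∧ a :: v <+: history e q₀ F x i)]
  congr 1
  ext i
  refine ind_congr ?_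
  rw [state_succ_eq_iff]
  constructor
  · rintro ⟨h1, h2⟩
    rw [history, if_pos (by rwa [(state_succ_eq_iff i q).mpr h1]), List.cons_prefix_cons] at h2
    obtain ⟨rfl, h2⟩ := h2
    exact ⟨⟨h1, h2⟩, rfl⟩
  · rintro ⟨⟨h1, h2⟩, rfl⟩
    refine ⟨h1, ?_⟩
    rw [history, if_pos (by rwa [(state_succ_eq_iff i q).mpr h1]), List.cons_prefix_cons]
    exact ⟨rfl, h2⟩

/-- For the empty word the function is harmonic everywhere, so the singleton of `q₀` can serve as
boundary. For `a :: v` the induction hypothesis makes the values on `F` constant. -/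
theorem mean_state_history_eq (hU : (U : Filter ℕ) ≤ atTop) (hx : IsNormal x) {f : Q} (hfF : f ∈ F)
    (hf : f ∈ reach e q₀) (v : List A) :
    ∀ q ∈ reach e q₀,
      mean U (fun i => ind (state e q₀ x i = q ∧ v <+: history e q₀ F x i)) =
        ((Fintype.card A : ℝ) ^ v.length)⁻¹ * mean U (fun i => ind (state e q₀ x i = q₀)) := by
  have : Nonempty A := ⟨x 0⟩
  induction v with
  | nil =>
    refine eq_of_harmonic_off (F := {q₀}) (Set.mem_singleton q₀) self_mem_reach ?_
      fun q hq _ => mean_state_history_of_not_mem hU hx (Or.inl rfl)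
    rintro q - rfl
    simp
  | cons a v ih =>
    refine eq_of_harmonic_off hfF hf ?_
      fun q hq hqF => mean_state_history_of_not_mem hU hx (Or.inr hqF)
    intro q hq hqF
    rw [mean_state_history_cons hU hx hqF, ih _ (symm_mem_of_forall_apply_mem (e a)
      (fun p hp => apply_mem_reach hp a) hq), List.length_cons, pow_succ, mul_inv, ← mul_assoc,
      mul_comm (Fintype.card A : ℝ)⁻¹]

/-- Reachable states have equal frequencies, and all frequencies sum to 1. -/
theorem mean_state_pos (hU : (U : Filter ℕ) ≤ atTop) (hx : IsNormal x) {f : Q}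
    (hf : f ∈ reach e q₀) : 0 < mean U (fun i => ind (state e q₀ x i = f)) := by
  have heq : ∀ q ∈ reach e q₀, mean U (fun i => ind (state e q₀ x i = q)) =
      mean U (fun i => ind (state e q₀ x i = q₀)) := by
    intro q hq
    simpa using mean_state_history_eq hU hx (F := Set.univ) (Set.mem_univ f) hf [] q hq
  have hnonneg : 0 ≤ mean U (fun i => ind (state e q₀ x i = f)) := by
    have := mean_mono (U := U) (Bdd.const 0) (Bdd.ind fun i => state e q₀ x i = f)
      fun i => ind_nonneg _
    rwa [mean_zero] at this
  refine hnonneg.lt_of_ne fun h0 => ?_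
  have hzero : ∀ q, mean U (fun i => ind (state e q₀ x i = q)) = 0 := by
    intro q
    by_cases hq : q ∈ reach e q₀
    · rw [heq q hq, ← heq f hf, h0]
    · rw [← mean_zero (U := U)]
      congr 1
      ext i
      exact ind_false fun h => hq (h ▸ state_mem_reach i)
  have hsum : mean U (fun i => ∑ q, ind (state e q₀ x i = q)) = 0 := by
    rw [mean_sum fun q _ => Bdd.ind _]
    simp [hzero]
  have hone : ∀ i, ∑ q, ind (state e q₀ x i = q) = 1 := by
    intro i
    simpa using sum_ind_eq (state e q₀ x i) fun _ => (1 : ℝ)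
  simp only [hone, mean_one hU] at hsum
  exact one_ne_zero hsum

theorem mean_selected_history (hU : (U : Filter ℕ) ≤ atTop) (hx : IsNormal x) {f : Q}
    (hfF : f ∈ F) (hf : f ∈ reach e q₀) (v : List A) :
    mean U (fun i => ind (state e q₀ x i ∈ F ∧ v <+: history e q₀ F x i)) =
      ((Fintype.card A : ℝ) ^ v.length)⁻¹ * mean U (fun i => ind (state e q₀ x i ∈ F)) := by
  have hsplit : ∀ w : List A,
      mean U (fun i => ind (state e q₀ x i ∈ F ∧ w <+: history e q₀ F x i)) =
        ∑ q, ind (q ∈ F) *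
          mean U (fun i => ind (state e q₀ x i = q ∧ w <+: history e q₀ F x i)) := by
    intro w
    simp only [← mean_const_mul (Bdd.ind _)]
    rw [← mean_sum fun q _ => (Bdd.const _).mul (Bdd.ind _)]
    congr 1
    ext i
    have h : ∀ q, ind (q ∈ F) * ind (state e q₀ x i = q ∧ w <+: history e q₀ F x i) =
        ind (state e q₀ x i = q) * ind (q ∈ F ∧ w <+: history e q₀ F x i) := by
      intro q
      rw [ind_and, ind_and]
      ring
    simp only [h]
    rw [sum_ind_eq (state e q₀ x i) fun q => ind (q ∈ F ∧ w <+: history e q₀ F x i)]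
  have hnil := hsplit []
  simp only [List.nil_prefix, and_true] at hnil
  rw [hsplit, hnil, Finset.mul_sum]
  refine Finset.sum_congr rfl fun q _ => ?_
  by_cases hq : q ∈ reach e q₀
  · have h1 := mean_state_history_eq hU hx hfF hf v q hq
    have h2 := mean_state_history_eq hU hx hfF hf [] q hq
    simp only [List.nil_prefix, and_true, List.length_nil, pow_zero, inv_one, one_mul] at h2
    rw [h1, h2]
    ring
  · have hne : ∀ i, state e q₀ x i ≠ q := fun i h => hq (h ▸ state_mem_reach i)
    simp [hne, ind, mean_zero]

theorem mean_selected_pos (hU : (U : Filter ℕ) ≤ atTop) (hx : IsNormal x) {f : Q}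
    (hfF : f ∈ F) (hf : f ∈ reach e q₀) : 0 < mean U (fun i => ind (state e q₀ x i ∈ F)) := by
  refine (mean_state_pos hU hx hf).trans_le (mean_mono (Bdd.ind _) (Bdd.ind _) fun i => ?_)
  by_cases h : state e q₀ x i = f
  · rw [ind_true h, ind_true (h ▸ hfF)]
  · rw [ind_false h]
    exact ind_nonneg _

end Selection

/-! ### From ultrafilter means to the selected sequence -/

section Counting

variable {A : Type*} {Q : Type*} {e : A → Equiv.Perm Q} {q₀ : Q} {F : Set Q} {x : ℕ → A}
  {L : Language A}

open Classical in
theorem history_eq_reverse (hsel : ∀ i, Selected x L i ↔ state e q₀ x (i + 1) ∈ F) (n : ℕ) :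
    history e q₀ F x n = (seqPrefix (select x L) (Nat.count (Selected x L) n)).reverse := by
  induction n with
  | zero => simp [history, seqPrefix]
  | succ n ih =>
    rw [history, ← hsel, Nat.count_succ]
    split_ifs with h
    · rw [seqPrefix_succ, List.reverse_append, ih, select, Nat.nth_count h]
      rfl
    · exact ih

open Classical in
-- An occurrence of `w` is counted at the position of `x` that selects its last symbol; the history
-- is stored backwards, whence the reversal.
theorem occ_select_count (hsel : ∀ i, Selected x L i ↔ state e q₀ x (i + 1) ∈ F) (w : List A)
    (n : ℕ) :
    (occ (seqPrefix (select x L) (Nat.count (Selected x L) n)) w : ℝ) =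
      ∑ i ∈ Finset.range n,
        ind (state e q₀ x (i + 1) ∈ F ∧ w.reverse <+: history e q₀ F x (i + 1)) := by
  induction n with
  | zero => simp [seqPrefix_zero, occ_nil]
  | succ n ih =>
    rw [Finset.sum_range_succ, ← ih, history_eq_reverse hsel, List.reverse_prefix,
      Nat.count_succ, ← hsel]
    by_cases h : Selected x L n
    · rw [if_pos h, seqPrefix_succ, occ_append_singleton]
      simp [h]
    · rw [if_neg h, add_zero, ind_false fun hh => h hh.1, add_zero]

open Classical in
theorem count_selected (hsel : ∀ i, Selected x L i ↔ state e q₀ x (i + 1) ∈ F) (n : ℕ) :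
    (Nat.count (Selected x L) n : ℝ) =
      ∑ i ∈ Finset.range n, ind (state e q₀ x (i + 1) ∈ F) := by
  induction n with
  | zero => simp
  | succ n ih =>
    rw [Finset.sum_range_succ, ← ih, Nat.count_succ, ← hsel]
    by_cases h : Selected x L n <;> simp [h, ind]

variable [Fintype A] [Fintype Q] {f : Q}

open Classical in
-- Along each ultrafilter the ratio is a quotient of two means with positive denominator, and the
-- same limit along all of them gives convergence.
theorem tendsto_occ_div_count (hx : IsNormal x)
    (hsel : ∀ i, Selected x L i ↔ state e q₀ x (i + 1) ∈ F) (hfF : f ∈ F)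
    (hf : f ∈ reach e q₀) (w : List A) :
    Tendsto (fun n => (occ (seqPrefix (select x L) (Nat.count (Selected x L) n)) w : ℝ) /
      (Nat.count (Selected x L) n : ℝ)) atTop (𝓝 (((Fintype.card A : ℝ) ^ w.length)⁻¹)) := by
  rw [tendsto_iff_ultrafilter]
  intro U hU
  have hpos := mean_selected_pos (e := e) (q₀ := q₀) hU hx hfF hf
  have h1 := tendsto_mean U (Bdd.ind fun i =>
    state e q₀ x (i + 1) ∈ F ∧ w.reverse <+: history e q₀ F x (i + 1))
  have h2 := tendsto_mean U (Bdd.ind fun i => state e q₀ x (i + 1) ∈ F)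
  rw [mean_succ hU (Bdd.ind fun i => state e q₀ x i ∈ F ∧ w.reverse <+: history e q₀ F x i),
    mean_selected_history hU hx hfF hf] at h1
  rw [mean_succ hU (Bdd.ind fun i => state e q₀ x i ∈ F)] at h2
  have h3 := h1.div h2 hpos.ne'
  rw [mul_div_cancel_right₀ _ hpos.ne', List.length_reverse] at h3
  refine Tendsto.congr' ?_ h3
  filter_upwards [hU (eventually_gt_atTop 0)] with n hn
  have hn' : (n : ℝ) ≠ 0 := by exact_mod_cast hn.ne'
  rw [occ_select_count hsel, count_selected hsel]
  exact div_div_div_cancel_right₀ hn' _ _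

theorem infinite_selected (hx : IsNormal x)
    (hsel : ∀ i, Selected x L i ↔ state e q₀ x (i + 1) ∈ F) (hfF : f ∈ F)
    (hf : f ∈ reach e q₀) : {i | Selected x L i}.Infinite := by
  intro hfin
  obtain ⟨N, hN⟩ := hfin.bddAbove
  obtain ⟨U, hU⟩ := Ultrafilter.exists_le (atTop : Filter ℕ)
  have hpos := mean_selected_pos (e := e) (q₀ := q₀) hU hx hfF hf
  -- Position `i + N + 1` lies beyond the bound `N`, and its selection is read off the state one
  -- index later.
  rw [← mean_shift hU (Bdd.ind _) (N + 2)] at hpos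
  have h0 : ∀ i, ind (state e q₀ x (i + (N + 2)) ∈ F) = 0 := by
    intro i
    refine ind_false fun h => ?_
    have := hN ((hsel (i + N + 1)).mpr h)
    omega
  simp only [h0, mean_zero] at hpos
  exact lt_irrefl _ hpos

theorem isNormal_select (hx : IsNormal x)
    (hsel : ∀ i, Selected x L i ↔ state e q₀ x (i + 1) ∈ F) (hfF : f ∈ F)
    (hf : f ∈ reach e q₀) : IsNormal (select x L) := by
  classical
  intro w
  have hinf : (Set.ofPred (Selected x L)).Infinite := infinite_selected hx hsel hfF hf
  -- Before the `n`-th selected position exactly `n` symbols have been selected, so this subsequence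
  -- runs through every prefix length.
  refine ((tendsto_occ_div_count hx hsel hfF hf w).comp
    (Nat.nth_strictMono hinf).tendsto_atTop).congr fun n => ?_
  simp only [Function.comp, Nat.count_nth_of_infinite hinf]

end Counting

end NormalSelection

theorem theorem2 {A : Type*} [Fintype A] (x : ℕ → A) (hx : NormalSelection.IsNormal x)
    (L : Language A) (hL : NormalSelection.IsGroupSet L) (hne : ∃ w : List A, w ∈ L) :
    {i : ℕ | NormalSelection.Selected x L i}.Infinite ∧
      NormalSelection.IsNormal (NormalSelection.select x L) := by
  obtain ⟨Q, _, M, hM, rfl⟩ := hL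
  obtain ⟨w, hw⟩ := hne
  let e : A → Equiv.Perm Q := fun a => Equiv.ofBijective _ (hM a)
  have hstate : ∀ i, M.eval (NormalSelection.seqPrefix x i) =
      NormalSelection.state e M.start x i := by
    intro i
    induction i with
    | zero => rfl
    | succ i ih =>
      rw [NormalSelection.seqPrefix_succ, DFA.eval_append_singleton, ih]
      rfl
  have hsel : ∀ i, NormalSelection.Selected x M.accepts i ↔
      NormalSelection.state e M.start x (i + 1) ∈ M.accept := by
    intro i
    rw [NormalSelection.Selected, DFA.mem_accepts, hstate]
  have hreach : M.eval w ∈ NormalSelection.reach e M.start := ⟨w, rfl⟩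
  exact ⟨NormalSelection.infinite_selected hx hsel hw hreach,
    NormalSelection.isNormal_select hx hsel hw hreach⟩
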